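/- Let $\pi : P \to M$ be a smooth fiber bundle (finite-dimensional smooth manifolds), with vertical spaces $V_pP = \ker T_p\pi$. A differential $N$-form $\alpha$ on $P$ is called $j$-horizontal ($0 \le j \le N$) if $\alpha_p(w_1,\dots,w_N) = 0$ whenever more than $N-j$ of the vectors $w_1,\dots,w_N \in T_pP$ are vertical. Let $0 \le r \le k+1$ and let $\omega$ be a smooth $(k+1-r)$-horizontal $(k+1)$-form on $P$. Its symbol $\hat\omega$ is the vertical $r$-form on $P$ with values in $\pi^*\bigl(\bigwedge^{k+1-r} T^*M\bigr)$ given by $$\hat\omega_p(v_1,\dots,v_r)(t_1,\dots,t_{k+1-r}) = \omega_p\bigl(v_1,\dots,v_r,\sigma t_1,\dots,\sigma t_{k+1-r}\bigr), \qquad v_i \in V_pP,\ t_j \in T_{\pi(p)}M,$$ where $\sigma : T_{\pi(p)}M \to T_pP$ is any linear map with $T_p\pi\circ\sigma = \mathrm{id}$ (the choice does not matter). For a vertical $r$-form $\alpha$ with values in $\pi^*\bigl(\bigwedge^{s} T^*M\bigr)$ the vertical exterior derivative $d_V\alpha$ is defined, for vertical vector fields $X_0,\dots,X_r$ on $P$,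 by $$d_V\alpha(X_0,\dots,X_r) = \sum_{i=0}^r (-1)^i X_i\cdot\bigl(\alpha(X_0,\dots,\widehat{X_i},\dots,X_r)\bigr) + \sum_{0\le i<j\le r} (-1)^{i+j}\alpha\bigl([X_i,X_j],X_0,\dots,\widehat{X_i},\dots,\widehat{X_j},\dots,X_r\bigr),$$ where for a vertical field $X$ and a section $\varphi$ of $\pi^*\bigl(\bigwedge^{s}T^*M\bigr)$ the section $X\cdot\varphi$ is the directional derivative along the fibers: on each fiber $P_m=\pi^{-1}(m)$ it is the derivative of the function $\varphi|_{P_m} : P_m \to \bigwedge^s T_m^*M$ in the direction of $X|_{P_m}$. Theorem. If $d\omega$ is $(k+2-r)$-horizontal, then $\hat\omega$ is vertically closed: $d_V\hat\omega = 0$. In particular, $d_V\hat\omega = 0$ if $d\omega = 0$. -/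

import Mathlib

open scoped Manifold ContDiff

namespace FibForm

noncomputable section

/-! ### Differential forms on a manifold and their exterior derivative -/

section Forms

variable {E : Type*} [NormedAddCommGroup E] [NormedSpace ℝ E]
  {P : Type*} [TopologicalSpace P] [ChartedSpace E P]

/-- A (not necessarily smooth) field of alternating `N`-forms on the tangent spaces of `P`. -/
abbrev FormField (E : Type*) [NormedAddCommGroup E] [NormedSpace ℝ E]
    (P : Type*) [TopologicalSpace P] [ChartedSpace E P] (N : ℕ) : Type _ :=
  Π p : P, (TangentSpace 𝓘(ℝ, E) p) [⋀^Fin N]→L[ℝ] ℝ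

/-- The coordinate expression of a form in the preferred chart at `p₀`: its pull-back to the
model space by the inverse of the chart. -/
def inChart {N : ℕ} (η : FormField E P N) (p₀ : P) (y : E) : E [⋀^Fin N]→L[ℝ] ℝ :=
  (η ((extChartAt 𝓘(ℝ, E) p₀).symm y)).compContinuousLinearMap
    (mfderiv 𝓘(ℝ, E) 𝓘(ℝ, E) (extChartAt 𝓘(ℝ, E) p₀).symm y)

/-- Smoothness of a differential form: all its coordinate expressions are smooth. -/
def IsSmoothForm {N : ℕ} (η : FormField E P N) : Prop :=
  ∀ p₀ : P, ContDiffOn ℝ ∞ (inChart η p₀) (extChartAt 𝓘(ℝ, E) p₀).target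

/-- The exterior derivative of a differential form on a manifold: at the point `p`, the exterior
derivative of the coordinate expression in the chart at `p`, pulled back to `T_p P`. -/
def extD {N : ℕ} (η : FormField E P N) : FormField E P (N + 1) := fun p =>
  (extDeriv (inChart η p) (extChartAt 𝓘(ℝ, E) p p)).compContinuousLinearMap
    (mfderiv 𝓘(ℝ, E) 𝓘(ℝ, E) (extChartAt 𝓘(ℝ, E) p) p)

end Forms

/-! ### Fiber bundles, the vertical bundle, vertical fields -/

section Bundles

variable {EM : Type*} [NormedAddCommGroup EM] [NormedSpace ℝ EM]
  {EP : Type*} [NormedAddCommGroup EP] [NormedSpace ℝ EP]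
  {M : Type*} [TopologicalSpace M] [ChartedSpace EM M]
  {P : Type*} [TopologicalSpace P] [ChartedSpace EP P]

/-- `π : P → M` is a smooth (locally trivial) fiber bundle with typical fiber the manifold `Q`. -/
structure IsSmoothFiberBundle (EM EP EQ : Type*)
    [NormedAddCommGroup EM] [NormedSpace ℝ EM]
    [NormedAddCommGroup EP] [NormedSpace ℝ EP]
    [NormedAddCommGroup EQ] [NormedSpace ℝ EQ]
    {M : Type*} [TopologicalSpace M] [ChartedSpace EM M]
    {P : Type*} [TopologicalSpace P] [ChartedSpace EP P]
    (Q : Type*) [TopologicalSpace Q] [ChartedSpace EQ Q] (π : P → M) : Prop where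
  smooth_proj : ContMDiff 𝓘(ℝ, EP) 𝓘(ℝ, EM) ∞ π
  exists_trivialization : ∀ m : M, ∃ e : Bundle.Trivialization Q π, m ∈ e.baseSet ∧
    ContMDiffOn 𝓘(ℝ, EP) (𝓘(ℝ, EM).prod 𝓘(ℝ, EQ)) ∞ e e.source ∧
    ContMDiffOn (𝓘(ℝ, EM).prod 𝓘(ℝ, EQ)) 𝓘(ℝ, EP) ∞ e.toOpenPartialHomeomorph.symm e.target

/-- The vertical space `V_p P = ker (T_p π)`. -/
abbrev verticalSpace (EM EP : Type*)
    [NormedAddCommGroup EM] [NormedSpace ℝ EM] [NormedAddCommGroup EP] [NormedSpace ℝ EP]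
    {M : Type*} [TopologicalSpace M] [ChartedSpace EM M]
    {P : Type*} [TopologicalSpace P] [ChartedSpace EP P] (π : P → M) (p : P) :
    Submodule ℝ (TangentSpace 𝓘(ℝ, EP) p) :=
  LinearMap.ker (mfderiv 𝓘(ℝ, EP) 𝓘(ℝ, EM) π p).toLinearMap

/-- Vertical fields: smooth sections of the vertical bundle. -/
structure VerticalField (EM EP : Type*)
    [NormedAddCommGroup EM] [NormedSpace ℝ EM] [NormedAddCommGroup EP] [NormedSpace ℝ EP]
    {M : Type*} [TopologicalSpace M] [ChartedSpace EM M]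
    {P : Type*} [TopologicalSpace P] [ChartedSpace EP P] [IsManifold 𝓘(ℝ, EP) ∞ P]
    (π : P → M) where
  toFun : Π p : P, verticalSpace EM EP π p
  smooth : ContMDiff 𝓘(ℝ, EP) 𝓘(ℝ, EP).tangent ∞
    (fun p => (⟨p, (toFun p : TangentSpace 𝓘(ℝ, EP) p)⟩ : TangentBundle 𝓘(ℝ, EP) P))

/-- An `N`-form `α` on `P` is `j`-horizontal (where `0 ≤ j ≤ N`) if it vanishes whenever more
than `N - j` of its arguments are vertical. -/
def IsHorizontal {N : ℕ} (π : P → M) (j : ℕ) (α : FormField EP P N) : Prop :=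
  ∀ (p : P) (w : Fin N → TangentSpace 𝓘(ℝ, EP) p),
    N < Nat.card {i : Fin N // w i ∈ verticalSpace EM EP π p} + j → α p w = 0

/-- Vertical `r`-forms on `P` with values in `π^* (⋀ˢ T^* M)`: fields of alternating `r`-forms on
the vertical spaces `V_p P` with values in `⋀ˢ T^*_{π p} M`. -/
abbrev VerticalForm (EM EP : Type*)
    [NormedAddCommGroup EM] [NormedSpace ℝ EM] [NormedAddCommGroup EP] [NormedSpace ℝ EP]
    {M : Type*} [TopologicalSpace M] [ChartedSpace EM M]
    {P : Type*} [TopologicalSpace P] [ChartedSpace EP P] (π : P → M) (r s : ℕ) : Type _ :=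
  Π p : P, (verticalSpace EM EP π p) [⋀^Fin r]→ₗ[ℝ]
    ((TangentSpace 𝓘(ℝ, EM) (π p)) [⋀^Fin s]→L[ℝ] ℝ)

/-- A section `φ` of `π^* (⋀ˢ T^* M)` as a function with values in the type `EM [⋀^Fin s]→L[ℝ] ℝ`
(every tangent space `T_m M` is `EM` as a type). Points in the same fiber have their values in the
same space `⋀ˢ T_m^* M`, so that on each fiber this function is the restriction of `φ`. -/
def asFunction {π : P → M} {s : ℕ}
    (φ : Π p : P, (TangentSpace 𝓘(ℝ, EM) (π p)) [⋀^Fin s]→L[ℝ] ℝ) :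
    P → EM [⋀^Fin s]→L[ℝ] ℝ := φ

/-- For a section `φ` of `π^* (⋀ˢ T^* M)` and `v ∈ V_p P`, the vertical directional derivative
`v · φ` at `p`: the derivative in the direction `v` of the restriction of `φ` to the fiber
`P_m = π⁻¹ {m}`, `m = π p`. (A derivative within the fiber is determined only on
vectors that are tangent to the fiber, and `v` is such a vector.) -/
def vertDirDeriv {π : P → M} {s : ℕ}
    (φ : Π p : P, (TangentSpace 𝓘(ℝ, EM) (π p)) [⋀^Fin s]→L[ℝ] ℝ)
    (p : P) (v : verticalSpace EM EP π p) :
    (TangentSpace 𝓘(ℝ, EM) (π p)) [⋀^Fin s]→L[ℝ] ℝ :=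
  mvfderivWithin 𝓘(ℝ, EP) (asFunction φ) (π ⁻¹' {π p}) p v

theorem fderiv_lieBracket_eq_zero {F : EP → EM} {U V : EP → EP} {y : EP}
    (hF : ContDiffAt ℝ ∞ F y) (hU : DifferentiableAt ℝ U y) (hV : DifferentiableAt ℝ V y)
    (hU0 : ∀ᶠ z in nhds y, fderiv ℝ F z (U z) = 0)
    (hV0 : ∀ᶠ z in nhds y, fderiv ℝ F z (V z) = 0) :
    fderiv ℝ F y (VectorField.lieBracket ℝ U V y) = 0 := by
  have hd : DifferentiableAt ℝ (fderiv ℝ F) y :=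
    (hF.fderiv_right (m := 1) (by rw [one_add_one_eq_two]; exact ENat.LEInfty.out)).differentiableAt one_ne_zero
  have hs : IsSymmSndFDerivAt ℝ F y := hF.isSymmSndFDerivAt (by simpa using ENat.LEInfty.out)
  have h1 : fderiv ℝ (fun z => fderiv ℝ F z (U z)) y = 0 := by
    rw [Filter.EventuallyEq.fderiv_eq (f₁ := fun z => fderiv ℝ F z (U z)) (f := fun _ => 0) hU0]
    simp
  have h2 : fderiv ℝ (fun z => fderiv ℝ F z (V z)) y = 0 := by
    rw [Filter.EventuallyEq.fderiv_eq (f₁ := fun z => fderiv ℝ F z (V z)) (f := fun _ => 0) hV0]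
    simp
  rw [fderiv_clm_apply hd hU] at h1
  rw [fderiv_clm_apply hd hV] at h2
  have e1 := congrArg (fun L => L (V y)) h1
  have e2 := congrArg (fun L => L (U y)) h2
  simp at e1 e2
  have e3 := hs.eq (U y) (V y)
  rw [VectorField.lieBracket, map_sub, sub_eq_zero]
  rw [e3, ← e1] at e2
  exact add_right_cancel e2

/-- The Lie bracket of two vertical fields is annihilated by `T π`. -/
theorem mfderiv_mlieBracket_eq_zero [CompleteSpace EP]
    [IsManifold 𝓘(ℝ, EM) ∞ M] [IsManifold 𝓘(ℝ, EP) ∞ P] {π : P → M}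
    (hπ : ContMDiff 𝓘(ℝ, EP) 𝓘(ℝ, EM) ∞ π) (X Y : VerticalField EM EP π) (p : P) :
    mfderiv 𝓘(ℝ, EP) 𝓘(ℝ, EM) π p
      (VectorField.mlieBracket 𝓘(ℝ, EP) (fun q => (X.toFun q : TangentSpace 𝓘(ℝ, EP) q))
        (fun q => (Y.toFun q : TangentSpace 𝓘(ℝ, EP) q)) p) = 0 := by
  have h1P : IsManifold 𝓘(ℝ, EP) 1 P := IsManifold.of_le (n := ∞) (by norm_num)
  have h2P : IsManifold 𝓘(ℝ, EP) 2 P := IsManifold.of_le (n := ∞) ENat.LEInfty.out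
  have h1M : IsManifold 𝓘(ℝ, EM) 1 M := IsManifold.of_le (n := ∞) (by norm_num)
  let F : EP → EM := writtenInExtChartAt 𝓘(ℝ, EP) 𝓘(ℝ, EM) p π
  let y₀ : EP := extChartAt 𝓘(ℝ, EP) p p
  let pull : VerticalField EM EP π → EP → EP := fun Z =>
    VectorField.mpullbackWithin 𝓘(ℝ, EP) 𝓘(ℝ, EP) (extChartAt 𝓘(ℝ, EP) p).symm
        (fun q => (Z.toFun q : TangentSpace 𝓘(ℝ, EP) q)) (Set.range 𝓘(ℝ, EP))
  have hFs : ContDiffAt ℝ ∞ F y₀ := by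
    have := (contMDiffAt_iff.1 (hπ p)).2
    rw [modelWithCornersSelf_coe, Set.range_id, contDiffWithinAt_univ] at this
    exact this
  have hmf : mfderiv 𝓘(ℝ, EP) 𝓘(ℝ, EM) π p = fderiv ℝ F y₀ := by
    rw [((hπ p).mdifferentiableAt (by simp)).mfderiv, modelWithCornersSelf_coe, Set.range_id,
      fderivWithin_univ]
  have hd : ∀ Z : VerticalField EM EP π, DifferentiableAt ℝ (pull Z) y₀ := by
    intro Z
    have := MDifferentiableWithinAt.differentiableWithinAt_mpullbackWithin_vectorField
      (I := 𝓘(ℝ, EP)) (s := Set.univ) (x := p)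
      (V := fun q => (Z.toFun q : TangentSpace 𝓘(ℝ, EP) q))
      ((Z.smooth p).mdifferentiableAt (by simp)).mdifferentiableWithinAt
    have hr : (extChartAt 𝓘(ℝ, EP) p).symm ⁻¹' Set.univ ∩ Set.range 𝓘(ℝ, EP) = Set.univ := by
      simp
    rw [hr] at this
    exact differentiableWithinAt_univ.1 this
  have h0 : ∀ Z : VerticalField EM EP π, ∀ᶠ y in nhds y₀, fderiv ℝ F y (pull Z y) = 0 := by
    intro Z
    have hev : ∀ᶠ y in nhds y₀, y ∈ (extChartAt 𝓘(ℝ, EP) p).target ∧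
        π ((extChartAt 𝓘(ℝ, EP) p).symm y) ∈ (extChartAt 𝓘(ℝ, EM) (π p)).source := by
      have h1 : Filter.Tendsto (extChartAt 𝓘(ℝ, EP) p).symm (nhds y₀) (nhds p) := by
        have := continuousAt_extChartAt_symm (I := 𝓘(ℝ, EP)) p
        rwa [ContinuousAt, extChartAt_to_inv] at this
      have h2 : Filter.Tendsto (fun y => π ((extChartAt 𝓘(ℝ, EP) p).symm y)) (nhds y₀)
          (nhds (π p)) := (hπ.continuous.tendsto p).comp h1
      have h3 : ∀ᶠ y in nhds y₀, y ∈ (extChartAt 𝓘(ℝ, EP) p).target :=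
        extChartAt_target_mem_nhds p
      exact h3.and
        (h2.eventually (extChartAt_source_mem_nhds (I := 𝓘(ℝ, EM)) (π p)))
    filter_upwards [hev] with y hy
    have hinv : (mfderiv 𝓘(ℝ, EP) 𝓘(ℝ, EP) (extChartAt 𝓘(ℝ, EP) p).symm y).IsInvertible := by
      have := isInvertible_mfderivWithin_extChartAt_symm (I := 𝓘(ℝ, EP)) hy.1
      rwa [modelWithCornersSelf_coe, Set.range_id, mfderivWithin_univ] at this
    have hp : mfderiv 𝓘(ℝ, EP) 𝓘(ℝ, EP) (extChartAt 𝓘(ℝ, EP) p).symm y (pull Z y)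
        = Z.toFun ((extChartAt 𝓘(ℝ, EP) p).symm y) := by
      have h1 : pull Z y = (mfderiv 𝓘(ℝ, EP) 𝓘(ℝ, EP) (extChartAt 𝓘(ℝ, EP) p).symm y).inverse
          (Z.toFun ((extChartAt 𝓘(ℝ, EP) p).symm y)) := by
        change VectorField.mpullbackWithin _ _ _ _ _ _ = _
        rw [VectorField.mpullbackWithin_apply, modelWithCornersSelf_coe, Set.range_id,
          mfderivWithin_univ]
      rw [h1]
      exact hinv.self_apply_inverse _
    have hm1 : MDifferentiableAt 𝓘(ℝ, EP) 𝓘(ℝ, EP) (extChartAt 𝓘(ℝ, EP) p).symm y := by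
      have := mdifferentiableWithinAt_extChartAt_symm (I := 𝓘(ℝ, EP)) hy.1
      rwa [modelWithCornersSelf_coe, Set.range_id, mdifferentiableWithinAt_univ] at this
    have hm2 : MDifferentiableAt 𝓘(ℝ, EP) 𝓘(ℝ, EM) π ((extChartAt 𝓘(ℝ, EP) p).symm y) :=
      (hπ _).mdifferentiableAt (by simp)
    have hm3 : MDifferentiableAt 𝓘(ℝ, EM) 𝓘(ℝ, EM) (extChartAt 𝓘(ℝ, EM) (π p))
        (π ((extChartAt 𝓘(ℝ, EP) p).symm y)) :=
      mdifferentiableAt_extChartAt (by simpa using hy.2)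
    have hc := HasMFDerivAt.comp y hm3.hasMFDerivAt
      (HasMFDerivAt.comp y hm2.hasMFDerivAt hm1.hasMFDerivAt)
    have hc' := hc.mfderiv
    have hv : mfderiv 𝓘(ℝ, EP) 𝓘(ℝ, EM) π ((extChartAt 𝓘(ℝ, EP) p).symm y)
        (Z.toFun ((extChartAt 𝓘(ℝ, EP) p).symm y)) = 0 := (Z.toFun _).2
    have h1 : fderiv ℝ F y (pull Z y) = mfderiv 𝓘(ℝ, EP) 𝓘(ℝ, EM) F y (pull Z y) :=
      congrArg (fun L : EP →L[ℝ] EM => L (pull Z y)) (mfderiv_eq_fderiv (f := F) (x := y)).symm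
    rw [h1]
    refine (congrArg (fun L : EP →L[ℝ] EM => L (pull Z y)) hc').trans ?_
    refine (congrArg (fun w => mfderiv 𝓘(ℝ, EM) 𝓘(ℝ, EM) (extChartAt 𝓘(ℝ, EM) (π p))
        (π ((extChartAt 𝓘(ℝ, EP) p).symm y)) (mfderiv 𝓘(ℝ, EP) 𝓘(ℝ, EM) π
          ((extChartAt 𝓘(ℝ, EP) p).symm y) w)) hp).trans ?_
    refine (congrArg (fun w => mfderiv 𝓘(ℝ, EM) 𝓘(ℝ, EM) (extChartAt 𝓘(ℝ, EM) (π p))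
        (π ((extChartAt 𝓘(ℝ, EP) p).symm y)) w) hv).trans ?_
    exact map_zero _
  have hb : VectorField.mlieBracket 𝓘(ℝ, EP) (fun q => (X.toFun q : TangentSpace 𝓘(ℝ, EP) q))
        (fun q => (Y.toFun q : TangentSpace 𝓘(ℝ, EP) q)) p
      = VectorField.lieBracket ℝ (pull X) (pull Y) y₀ := by
    rw [VectorField.mlieBracket, VectorField.mlieBracketWithin_apply, mfderiv_extChartAt_self]
    refine (congrArg (fun L : EP →L[ℝ] EP => L _)
      (ContinuousLinearMap.inverse_id (R := ℝ) (M := EP))).trans ?_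
    have hr : (extChartAt 𝓘(ℝ, EP) p).symm ⁻¹' Set.univ ∩ Set.range 𝓘(ℝ, EP) = Set.univ := by
      simp
    rw [hr]
    exact congrFun (VectorField.lieBracketWithin_univ (V := pull X) (W := pull Y)) y₀
  have h := fderiv_lieBracket_eq_zero hFs (hd X) (hd Y) (h0 X) (h0 Y)
  rw [hmf, hb]
  exact h

/-- The Lie bracket of vertical fields, which is a vertical field. -/
def VerticalField.bracket [FiniteDimensional ℝ EP]
    [IsManifold 𝓘(ℝ, EM) ∞ M] [IsManifold 𝓘(ℝ, EP) ∞ P] {π : P → M}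
    (hπ : ContMDiff 𝓘(ℝ, EP) 𝓘(ℝ, EM) ∞ π) (X Y : VerticalField EM EP π) :
    VerticalField EM EP π where
  toFun p := ⟨VectorField.mlieBracket 𝓘(ℝ, EP)
      (fun q => (X.toFun q : TangentSpace 𝓘(ℝ, EP) q))
      (fun q => (Y.toFun q : TangentSpace 𝓘(ℝ, EP) q)) p, by
    have : CompleteSpace EP := FiniteDimensional.complete ℝ EP
    exact mfderiv_mlieBracket_eq_zero hπ X Y p⟩
  smooth := by
    have : CompleteSpace EP := FiniteDimensional.complete ℝ EP
    have h2 : IsManifold 𝓘(ℝ, EP) (minSmoothness ℝ 2) P :=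
      IsManifold.of_le (n := ∞) (by simpa using ENat.LEInfty.out)
    have h3 : IsManifold 𝓘(ℝ, EP) (((⊤ : ℕ∞) : WithTop ℕ∞) + 1) P :=
      IsManifold.of_le (n := ∞) (by simp)
    exact ContDiff.mlieBracket_vectorField (m := ⊤) (n := ⊤) X.smooth Y.smooth (by simp)

/-- A fiber bundle projection has a linear splitting `T_{π p} M → T_p P` at every point `p`. -/
theorem exists_splitting {EQ : Type*} [NormedAddCommGroup EQ] [NormedSpace ℝ EQ]
    {Q : Type*} [TopologicalSpace Q] [ChartedSpace EQ Q] {π : P → M}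
    (hπ : IsSmoothFiberBundle EM EP EQ Q π) (p : P) :
    ∃ σ : TangentSpace 𝓘(ℝ, EM) (π p) →L[ℝ] TangentSpace 𝓘(ℝ, EP) p,
      ∀ t, mfderiv 𝓘(ℝ, EP) 𝓘(ℝ, EM) π p (σ t) = t := by
  obtain ⟨e, he, -, hes⟩ := hπ.exists_trivialization (π p)
  have hps : p ∈ e.source := e.mem_source.2 he
  let ψ : M → P := fun m => e.toOpenPartialHomeomorph.symm (m, (e p).2)
  have hψp : ψ (π p) = p := e.symm_apply_mk_proj hps
  have htar : ∀ m ∈ e.baseSet, (m, (e p).2) ∈ e.target := fun m hm => e.mem_target.2 hm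
  have hψ : MDifferentiableAt 𝓘(ℝ, EM) 𝓘(ℝ, EP) ψ (π p) := by
    have h1 : ContMDiffAt (𝓘(ℝ, EM).prod 𝓘(ℝ, EQ)) 𝓘(ℝ, EP) ∞
        e.toOpenPartialHomeomorph.symm (π p, (e p).2) :=
      hes.contMDiffAt (e.open_target.mem_nhds (htar _ he))
    exact (ContMDiffAt.comp (π p) h1
      (contMDiffAt_id.prodMk contMDiffAt_const)).mdifferentiableAt (by simp)
  have hπd : MDifferentiableAt 𝓘(ℝ, EP) 𝓘(ℝ, EM) π (ψ (π p)) :=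
    (hπ.smooth_proj _).mdifferentiableAt (by simp)
  have hcomp := mfderiv_comp (π p) hπd hψ
  have hid : mfderiv 𝓘(ℝ, EM) 𝓘(ℝ, EM) (π ∘ ψ) (π p) = ContinuousLinearMap.id ℝ _ := by
    have hev : π ∘ ψ =ᶠ[nhds (π p)] id := by
      filter_upwards [e.open_baseSet.mem_nhds he] with m hm
      exact e.proj_symm_apply (htar m hm)
    exact hev.mfderiv_eq.trans mfderiv_id
  refine ⟨mfderiv 𝓘(ℝ, EM) 𝓘(ℝ, EP) ψ (π p), fun t => ?_⟩
  have h2 := congrArg (fun L : EM →L[ℝ] EM => L t) (hcomp.symm.trans hid)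
  rw [hψp] at h2
  exact h2

/-- A linear splitting of `0 → V_p P → T_p P → T_{π p} M → 0` (an arbitrary one). -/
def splitting {EQ : Type*} [NormedAddCommGroup EQ] [NormedSpace ℝ EQ]
    {Q : Type*} [TopologicalSpace Q] [ChartedSpace EQ Q] {π : P → M}
    (hπ : IsSmoothFiberBundle EM EP EQ Q π) (p : P) :
    TangentSpace 𝓘(ℝ, EM) (π p) →L[ℝ] TangentSpace 𝓘(ℝ, EP) p :=
  (exists_splitting hπ p).choose

theorem append_update_left {W : Type*} {r s : ℕ} (v : Fin r → W) (t : Fin s → W) (i : Fin r)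
    (x : W) : Fin.append (Function.update v i x) t
      = Function.update (Fin.append v t) (Fin.castAdd s i) x := by
  funext l
  refine Fin.addCases (fun a => ?_) (fun b => ?_) l
  · by_cases h : a = i <;> simp [h]
  · have h : Fin.natAdd r b ≠ Fin.castAdd s i := by
      intro h
      have := congrArg Fin.val h
      simp at this
      omega
    simp [h]

theorem append_update_right {W : Type*} {r s : ℕ} (v : Fin r → W) (t : Fin s → W) (i : Fin s)
    (x : W) : Fin.append v (Function.update t i x)
      = Function.update (Fin.append v t) (Fin.natAdd r i) x := by
  funext l
  refine Fin.addCases (fun a => ?_) (fun b => ?_) l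
  · have h : Fin.castAdd s a ≠ Fin.natAdd r i := by
      intro h
      have := congrArg Fin.val h
      simp at this
      omega
    simp [h]
  · by_cases h : b = i <;> simp [h]

/-- The arguments `(v₁, …, v_r, σ t₁, …, σ t_s)`, for `N = r + s`. -/
def symbolArgs {W T : Type*} [AddCommGroup W] [Module ℝ W] [TopologicalSpace W]
    [AddCommGroup T] [Module ℝ T] [TopologicalSpace T] {N r s : ℕ} (h : N = r + s)
    {V : Submodule ℝ W} (σ : T →L[ℝ] W) (v : Fin r → V) (t : Fin s → T) : Fin N → W := fun l =>
  Fin.append (fun a => (v a : W)) (fun b => σ (t b)) (Fin.cast h l)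

section

variable {W T : Type*} [AddCommGroup W] [Module ℝ W] [TopologicalSpace W]
    [AddCommGroup T] [Module ℝ T] [TopologicalSpace T] {N r s : ℕ} {V : Submodule ℝ W}

theorem symbolArgs_update_left (h : N = r + s) (σ : T →L[ℝ] W) [DecidableEq (Fin r)]
    (v : Fin r → V) (t : Fin s → T) (i : Fin r) (x : V) :
    symbolArgs h σ (Function.update v i x) t
      = Function.update (symbolArgs h σ v t) (Fin.cast h.symm (Fin.castAdd s i)) x := by
  subst h
  change Fin.append _ _ = Function.update (Fin.append _ _) (Fin.castAdd s i) _
  rw [← append_update_left]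
  congr 1
  funext a
  by_cases h : a = i
  · subst h; simp
  · simp [h]

theorem symbolArgs_update_right (h : N = r + s) (σ : T →L[ℝ] W) [DecidableEq (Fin s)]
    (v : Fin r → V) (t : Fin s → T) (i : Fin s) (x : T) :
    symbolArgs h σ v (Function.update t i x)
      = Function.update (symbolArgs h σ v t) (Fin.cast h.symm (Fin.natAdd r i)) (σ x) := by
  subst h
  change Fin.append _ _ = Function.update (Fin.append _ _) (Fin.natAdd r i) _
  rw [← append_update_right]
  congr 1
  funext a
  by_cases h : a = i
  · subst h; simp
  · simp [h]

theorem continuous_symbolArgs (h : N = r + s) (σ : T →L[ℝ] W) (v : Fin r → V) :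
    Continuous (fun t : Fin s → T => symbolArgs h σ v t) := by
  subst h
  refine continuous_pi fun l => ?_
  refine Fin.addCases (fun a => ?_) (fun b => ?_) l
  · simp only [symbolArgs, Fin.cast_eq_self, Fin.append_left]
    exact continuous_const
  · simp only [symbolArgs, Fin.cast_eq_self, Fin.append_right]
    exact σ.continuous.comp (continuous_apply b)

end

/-- The symbol of an alternating `N`-form `α` on `W`, `N = r + s`, along a subspace `V ⊆ W`, with
respect to a linear map `σ : T → W`:
`(v₁, …, v_r) ↦ ((t₁, …, t_s) ↦ α (v₁, …, v_r, σ t₁, …, σ t_s))`. -/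
def linearSymbol {W T : Type*} [AddCommGroup W] [Module ℝ W] [TopologicalSpace W]
    [AddCommGroup T] [Module ℝ T] [TopologicalSpace T]
    {N r s : ℕ} (h : N = r + s) (V : Submodule ℝ W) (σ : T →L[ℝ] W)
    (α : W [⋀^Fin N]→L[ℝ] ℝ) : V [⋀^Fin r]→ₗ[ℝ] (T [⋀^Fin s]→L[ℝ] ℝ) where
  toFun v :=
    { toFun := fun t => α (symbolArgs h σ v t)
      map_update_add' := fun t i x y => by
        rw [symbolArgs_update_right, symbolArgs_update_right, symbolArgs_update_right, map_add,
          α.map_update_add]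
      map_update_smul' := fun t i c x => by
        rw [symbolArgs_update_right, symbolArgs_update_right, map_smul, α.map_update_smul]
      map_eq_zero_of_eq' := fun t i j hij hne =>
        α.map_eq_zero_of_eq _ (i := Fin.cast h.symm (Fin.natAdd r i))
          (j := Fin.cast h.symm (Fin.natAdd r j))
          (by simp [symbolArgs, hij]) (by simpa using hne)
      cont := α.cont.comp (continuous_symbolArgs h σ v) }
  map_update_add' v i x y := by
    ext t
    change α _ = α _ + α _
    rw [symbolArgs_update_left, symbolArgs_update_left, symbolArgs_update_left,
      Submodule.coe_add, α.map_update_add]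
  map_update_smul' v i c x := by
    ext t
    change α _ = c • α _
    rw [symbolArgs_update_left, symbolArgs_update_left, Submodule.coe_smul, α.map_update_smul]
  map_eq_zero_of_eq' v i j hij hne := by
    ext t
    exact α.map_eq_zero_of_eq _ (i := Fin.cast h.symm (Fin.castAdd s i))
      (j := Fin.cast h.symm (Fin.castAdd s j)) (by simp [symbolArgs, hij]) (by simpa using hne)

/-- The symbol of an `(N - r)`-horizontal `N`-form `η` on the total space of a fiber bundle, where
`N = r + s`: at every point `p` it is the symbol of `η p` with respect to a splitting of
`T_p P → T_{π p} M`. (By horizontality, it does not depend on the choice of the splitting.) -/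
def symbol {EQ : Type*} [NormedAddCommGroup EQ] [NormedSpace ℝ EQ]
    {Q : Type*} [TopologicalSpace Q] [ChartedSpace EQ Q] {π : P → M}
    (hπ : IsSmoothFiberBundle EM EP EQ Q π) {N r s : ℕ} (h : N = r + s) (η : FormField EP P N) :
    VerticalForm EM EP π r s := fun p =>
  linearSymbol h (verticalSpace EM EP π p) (splitting hπ p) (η p)

section VerticalDerivative

variable [FiniteDimensional ℝ EP] [IsManifold 𝓘(ℝ, EM) ∞ M] [IsManifold 𝓘(ℝ, EP) ∞ P]

/-- The part of the vertical exterior derivative of an `r`-form that contains Lie brackets,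
`∑_{0 ≤ i < j ≤ r} (-1)^(i+j) α([X_i, X_j], X_0, …, X̂_i, …, X̂_j, …, X_r)`.
It is empty if `r = 0`. If `r = r' + 1`, the pairs `i < j` are written `(i, j + 1)` with
`i ≤ j` in `Fin (r' + 1)`. -/
def bracketSum {π : P → M} (hπ : ContMDiff 𝓘(ℝ, EP) 𝓘(ℝ, EM) ∞ π) {s : ℕ} :
    {r : ℕ} → VerticalForm EM EP π r s → (Fin (r + 1) → VerticalField EM EP π) →
      Π p : P, (TangentSpace 𝓘(ℝ, EM) (π p)) [⋀^Fin s]→L[ℝ] ℝ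
  | 0, _, _, _ => 0
  | r + 1, α, X, p => ∑ i : Fin (r + 1), ∑ j ≥ i, (-1 : ℝ) ^ ((i : ℕ) + ((j : ℕ) + 1)) •
      α p (Fin.cons (((X i.castSucc).bracket hπ (X j.succ)).toFun p)
        (fun l => (X (i.castSucc.succAbove (j.succAbove l))).toFun p))

/-- The vertical exterior derivative of a vertical `r`-form, as a function of `r + 1` vertical
fields:
`d_V α (X_0, …, X_r) = ∑_{i} (-1)^i X_i · (α(X_0, …, X̂_i, …, X_r))
  + ∑_{i < j} (-1)^(i+j) α([X_i, X_j], X_0, …, X̂_i, …, X̂_j, …, X_r)`. -/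
def vertExtD {π : P → M} (hπ : ContMDiff 𝓘(ℝ, EP) 𝓘(ℝ, EM) ∞ π) {r s : ℕ}
    (α : VerticalForm EM EP π r s) (X : Fin (r + 1) → VerticalField EM EP π) (p : P) :
    (TangentSpace 𝓘(ℝ, EM) (π p)) [⋀^Fin s]→L[ℝ] ℝ :=
  ∑ i : Fin (r + 1), (-1 : ℝ) ^ (i : ℕ) •
      vertDirDeriv (fun q => α q (fun l => (X (i.succAbove l)).toFun q)) p ((X i).toFun p)
    + bracketSum hπ α X p

end VerticalDerivative

end Bundles

end

end FibForm

open FibForm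

/-! Write `s = k + 1 - r` and evaluate `dη` on `r + 1` vertical fields `X_i` and on `s` lifts of
constant fields `t_b` of a chart of `M`. These arguments contain more than `r` vertical vectors, so
horizontality of `dη` makes the left side of Cartan's formula vanish. On the right, a derivative
along a lift differentiates `η` on `r + 1` vertical fields, which is identically zero nearby. Every
bracket is vertical, because all the fields project to constant fields, whose brackets are zero; a
bracket involving a lift leaves at least `r` of the `X_i` as further arguments, so `η` vanishes
there too. What survives is the formula for `d_V` of the symbol (`sum_fderiv_eq_sum_lieBracket`).

It remains to identify the surviving terms with `vertExtD`. The symbol is built from an arbitrary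
splitting, possibly discontinuous in the point, but horizontality lets any other lift replace it
(`map_appendArgs_congr`). A differentiable family of lifts exists near each point
(`exists_rightInverse_fderiv`). On the fiber through `p` the symbol therefore equals a
differentiable function of the chart coordinates (`symbol_apply_eq_inChart`), and its derivative
along the fiber is the ordinary derivative of that function (`vertDirDeriv_eq_fderiv`). -/

namespace FibForm

/-! ### Arguments of the form `(v₁, …, v_r, u₁, …, u_s)` -/

section AppendArgs

variable {W : Type*} {N r s : ℕ}

/-- The concatenation `(v₁, …, v_r, u₁, …, u_s)` as a family indexed by `Fin N`, `N = r + s`. -/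
def appendArgs (h : N = r + s) (v : Fin r → W) (u : Fin s → W) : Fin N → W :=
  fun l => Fin.append v u (Fin.cast h l)

theorem appendArgs_of_lt (h : N = r + s) (v : Fin r → W) (u : Fin s → W) {l : Fin N}
    (hl : (l : ℕ) < r) : appendArgs h v u l = v ⟨l, hl⟩ :=
  Fin.append_left v u ⟨l, hl⟩

theorem appendArgs_of_ge (h : N = r + s) (v : Fin r → W) (u : Fin s → W) {l : Fin N}
    (hl : r ≤ (l : ℕ)) : appendArgs h v u l = u ⟨l - r, by omega⟩ := by
  rw [appendArgs, ← Fin.append_right v u]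
  congr 1
  ext
  simp; omega

theorem comp_appendArgs {W' : Type*} (h : N = r + s) (f : W → W') (v : Fin r → W)
    (u : Fin s → W) : (fun l => f (appendArgs h v u l))
      = appendArgs h (fun a => f (v a)) fun b => f (u b) := by
  funext l
  by_cases hl : (l : ℕ) < r
  · simp only [appendArgs_of_lt _ _ _ hl]
  · simp only [appendArgs_of_ge _ _ _ (not_lt.1 hl)]

/-- With `vecCons_appendArgs`, this matches the terms of Cartan's formula with those of `d_V`:
omitting a vertical field leaves the lifts in place, and a bracket put in front joins the vertical
block. -/
theorem removeNth_appendArgs (h : N = r + s) (h' : N + 1 = r + 1 + s) (v : Fin (r + 1) → W)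
    (u : Fin s → W) (i : Fin (N + 1)) (a : Fin (r + 1)) (hi : (i : ℕ) = a) :
    i.removeNth (appendArgs h' v u) = appendArgs h (a.removeNth v) u := by
  funext l
  rw [Fin.removeNth_apply]
  have hs : ((i.succAbove l : Fin (N + 1)) : ℕ) = if (l : ℕ) < i then (l : ℕ) else l + 1 := by
    simp only [Fin.succAbove, Fin.lt_def, Fin.val_castSucc]
    split_ifs <;> simp
  have ha := a.2
  by_cases hl : (l : ℕ) < r
  · have h1 : ((i.succAbove l : Fin (N + 1)) : ℕ) < r + 1 := by rw [hs]; split_ifs <;> omega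
    rw [appendArgs_of_lt _ _ _ h1, appendArgs_of_lt _ _ _ hl, Fin.removeNth_apply]
    congr 1
    ext
    simp only [Fin.succAbove, Fin.lt_def, Fin.val_castSucc, hi]
    split_ifs <;> simp
  · have h1 : r + 1 ≤ ((i.succAbove l : Fin (N + 1)) : ℕ) := by rw [hs]; split_ifs <;> omega
    rw [appendArgs_of_ge _ _ _ h1, appendArgs_of_ge _ _ _ (not_lt.1 hl)]
    congr 1
    ext
    simp only [hs]
    split_ifs <;> omega

theorem vecCons_appendArgs (h : N = r + s) (h' : N + 1 = r + 1 + s) (b : W) (v : Fin r → W)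
    (u : Fin s → W) :
    Matrix.vecCons b (appendArgs h v u) = appendArgs h' (Fin.cons b v) u := by
  funext l
  refine Fin.cases ?_ (fun l => ?_) l
  · rw [appendArgs_of_lt _ _ _ (by simp)]
    rfl
  · rw [Matrix.cons_val_succ]
    by_cases hl : (l : ℕ) < r
    · rw [appendArgs_of_lt _ _ _ hl, appendArgs_of_lt _ _ _ (l := l.succ) (by simpa using hl)]
      rfl
    · rw [appendArgs_of_ge _ _ _ (not_lt.1 hl),
        appendArgs_of_ge _ _ _ (l := l.succ) (by simpa using hl)]
      congr 1
      ext
      simp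

end AppendArgs

/-! ### Truncation of the sums in Cartan's formula -/

theorem sum_eq_sum_castLE {G : Type*} [AddCommMonoid G] {m n : ℕ} (h : m ≤ n) (f : Fin n → G)
    (h0 : ∀ i : Fin n, m ≤ (i : ℕ) → f i = 0) :
    ∑ i, f i = ∑ i : Fin m, f (Fin.castLE h i) := by
  obtain ⟨d, rfl⟩ := Nat.exists_eq_add_of_le h
  rw [Fin.sum_univ_add, Finset.sum_eq_zero (s := Finset.univ) (f := fun i => f (Fin.natAdd m i)),
    add_zero]
  · rfl
  · exact fun i _ => h0 _ (by simp)

/-- Vanishing for large `j` is enough: since `i ≤ j`, a pair with `i` beyond `m` also has `j` beyond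
`m`. -/
theorem sum_sum_Ici_eq_castLE {G : Type*} [AddCommMonoid G] {m n : ℕ} (h : m ≤ n)
    (f : Fin n → Fin n → G) (h0 : ∀ i j : Fin n, i ≤ j → m ≤ (j : ℕ) → f i j = 0) :
    ∑ i, ∑ j ≥ i, f i j = ∑ i : Fin m, ∑ j ≥ i, f (Fin.castLE h i) (Fin.castLE h j) := by
  have hI (k : ℕ) (g : Fin k → G) (i : Fin k) : ∑ j ≥ i, g j = ∑ j, if i ≤ j then g j else 0 := by
    rw [← Finset.sum_filter]
    congr 1
    ext
    simp
  simp only [hI]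
  rw [sum_eq_sum_castLE h]
  · refine Finset.sum_congr rfl fun i _ => ?_
    rw [sum_eq_sum_castLE h]
    · rfl
    · intro j hj
      split_ifs with hij
      exacts [h0 _ _ hij hj, rfl]
  · refine fun i hi => Finset.sum_eq_zero fun j _ => ?_
    split_ifs with hij
    exacts [h0 _ _ hij (hi.trans hij), rfl]

/-! ### Cartan's formula in the model space -/

section Local

variable {EM : Type*} [NormedAddCommGroup EM] [NormedSpace ℝ EM]
  {EP : Type*} [NormedAddCommGroup EP] [NormedSpace ℝ EP]

/-- The Lie bracket of two fields that are related to constant fields is annihilated by the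
derivative. -/
theorem fderiv_lieBracket_eq_zero_of_const {F : EP → EM} {U V : EP → EP} {y : EP} {a b : EM}
    (hF : ContDiffAt ℝ ∞ F y) (hU : DifferentiableAt ℝ U y) (hV : DifferentiableAt ℝ V y)
    (hU0 : ∀ᶠ z in nhds y, fderiv ℝ F z (U z) = a)
    (hV0 : ∀ᶠ z in nhds y, fderiv ℝ F z (V z) = b) :
    fderiv ℝ F y (VectorField.lieBracket ℝ U V y) = 0 := by
  have hd : DifferentiableAt ℝ (fderiv ℝ F) y :=
    (hF.fderiv_right (m := 1)
      (by rw [one_add_one_eq_two]; exact ENat.LEInfty.out)).differentiableAt one_ne_zero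
  have hs : IsSymmSndFDerivAt ℝ F y := hF.isSymmSndFDerivAt (by simpa using ENat.LEInfty.out)
  have h1 : fderiv ℝ (fun z => fderiv ℝ F z (U z)) y = 0 := by
    rw [Filter.EventuallyEq.fderiv_eq (f₁ := fun z => fderiv ℝ F z (U z)) (f := fun _ => a) hU0]
    simp
  have h2 : fderiv ℝ (fun z => fderiv ℝ F z (V z)) y = 0 := by
    rw [Filter.EventuallyEq.fderiv_eq (f₁ := fun z => fderiv ℝ F z (V z)) (f := fun _ => b) hV0]
    simp
  -- Differentiating `DF(U) = a` along `V` and `DF(V) = b` along `U` gives `D²F(V, U) + DF(DU V) =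
  -- 0` and `D²F(U, V) + DF(DV U) = 0`. Symmetry of `D²F` leaves `DF(DV U) = DF(DU V)`.
  rw [fderiv_clm_apply hd hU] at h1
  rw [fderiv_clm_apply hd hV] at h2
  have e1 := congrArg (fun L => L (V y)) h1
  have e2 := congrArg (fun L => L (U y)) h2
  simp at e1 e2
  have e3 := hs.eq (U y) (V y)
  rw [VectorField.lieBracket, map_sub, sub_eq_zero]
  rw [e3, ← e1] at e2
  exact add_right_cancel e2

/-- The sum of the terms `(-1)^(i+j) β([X_i, X_j], X_0, …, X̂_i, …, X̂_j, …, X_r, u_1, …, u_s)`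
over `i < j ≤ r` at the point `y`, with the opposite sign. The pairs `i < j` are written
`(i, j + 1)` with `i ≤ j`. -/
noncomputable def lieBracketSum {k s : ℕ} (β : EP [⋀^Fin (k + 1)]→L[ℝ] ℝ) (y : EP)
    (u : Fin s → EP) : {r : ℕ} → k + 1 = r + s → (Fin (r + 1) → EP → EP) → ℝ
  | 0, _, _ => 0
  | r + 1, h, X => ∑ i : Fin (r + 1), ∑ j ≥ i, (-1) ^ (i + j : ℕ) * β (appendArgs h
      (Fin.cons (VectorField.lieBracket ℝ (X i.castSucc) (X j.succ) y)
        (j.removeNth (i.castSucc.removeNth fun l => X l y))) u)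

/-- Cartan's formula for a form `β` that vanishes on more than `r` vertical vectors, with `d β`
vanishing on more than `r` vertical vectors at the point `y₀`: only the derivatives along the
vertical fields and the brackets of the vertical fields remain. Here the fiber directions are the
kernels of the derivative of a map `F`. -/
theorem sum_fderiv_eq_sum_lieBracket {k r s : ℕ} (h : k + 1 = r + s) {F : EP → EM}
    {β : EP → EP [⋀^Fin (k + 1)]→L[ℝ] ℝ} {y₀ : EP} {A : EP → EM →L[ℝ] EP}
    {X : Fin (r + 1) → EP → EP} (hF : ContDiffAt ℝ ∞ F y₀) (hβ : DifferentiableAt ℝ β y₀)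
    (hA : DifferentiableAt ℝ A y₀) (hFA : ∀ᶠ y in nhds y₀, ∀ t, fderiv ℝ F y (A y t) = t)
    (hX : ∀ i, DifferentiableAt ℝ (X i) y₀)
    (hX0 : ∀ᶠ y in nhds y₀, ∀ i, fderiv ℝ F y (X i y) = 0)
    (hhor : ∀ᶠ y in nhds y₀, ∀ (w : Fin (k + 1) → EP) (f : Fin (r + 1) → Fin (k + 1)),
      Function.Injective f → (∀ a, fderiv ℝ F y (w (f a)) = 0) → β y w = 0)
    (hd : ∀ (w : Fin (k + 2) → EP) (f : Fin (r + 1) → Fin (k + 2)),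
      Function.Injective f → (∀ a, fderiv ℝ F y₀ (w (f a)) = 0) → extDeriv β y₀ w = 0)
    (t : Fin s → EM) :
    ∑ i : Fin (r + 1), (-1) ^ (i : ℕ) * fderiv ℝ (fun y => β y (appendArgs h
        (i.removeNth fun l => X l y) fun b => A y (t b))) y₀ (X i y₀)
      = lieBracketSum (β y₀) y₀ (fun b => A y₀ (t b)) h X := by
  have h' : k + 2 = r + 1 + s := by omega
  set V : Fin (k + 2) → EP → EP :=
    fun l y => appendArgs h' (fun i => X i y) (fun b => A y (t b)) l with hV
  have hVX (l : Fin (k + 2)) (hl : (l : ℕ) < r + 1) : V l = X ⟨l, hl⟩ := by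
    funext y
    exact appendArgs_of_lt _ _ _ hl
  have hVA (l : Fin (k + 2)) (hl : r + 1 ≤ (l : ℕ)) :
      V l = fun y => A y (t ⟨l - (r + 1), by omega⟩) := by
    funext y
    exact appendArgs_of_ge _ _ _ hl
  have hVd (l : Fin (k + 2)) : DifferentiableAt ℝ (V l) y₀ := by
    by_cases hl : (l : ℕ) < r + 1
    · rw [hVX l hl]; exact hX _
    · rw [hVA l (not_lt.1 hl)]
      exact hA.clm_apply (differentiableAt_const _)
  -- Each field projects to a constant: `0` for the vertical fields, `t_b` for the lifts. This is
  -- why the lifts are taken to be right inverses of `DF` on a whole neighbourhood.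
  have hVc (l : Fin (k + 2)) : ∃ c, ∀ᶠ y in nhds y₀, fderiv ℝ F y (V l y) = c := by
    by_cases hl : (l : ℕ) < r + 1
    · rw [hVX l hl]; exact ⟨0, hX0.mono fun y hy => hy _⟩
    · rw [hVA l (not_lt.1 hl)]
      exact ⟨_, hFA.mono fun y hy => hy _⟩
  have hbr (l l' : Fin (k + 2)) :
      fderiv ℝ F y₀ (VectorField.lieBracket ℝ (V l) (V l') y₀) = 0 :=
    fderiv_lieBracket_eq_zero_of_const hF (hVd l) (hVd l') (hVc l).choose_spec
      (hVc l').choose_spec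
  have hV0 : ∀ᶠ y in nhds y₀, ∀ l : Fin (k + 2), (l : ℕ) < r + 1 → fderiv ℝ F y (V l y) = 0 := by
    filter_upwards [hX0] with y hy l hl
    rw [hVX l hl]
    exact hy _
  have key := extDeriv_apply_vectorField hβ hVd
  rw [hd _ (Fin.castLE (by omega)) (Fin.castLE_injective _)
    fun a => hV0.self_of_nhds _ a.2, eq_comm, sub_eq_zero] at key
  rw [sum_eq_sum_castLE (m := r + 1) (by omega)] at key
  · refine Eq.trans (Finset.sum_congr rfl fun i _ => ?_) (key.trans ?_)
    · have h1 (y : EP) : (Fin.castLE (by omega) i : Fin (k + 2)).removeNth (fun l => V l y)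
          = appendArgs h (i.removeNth fun l => X l y) fun b => A y (t b) :=
        removeNth_appendArgs h h' _ _ _ _ rfl
      simp only [h1, hVX (Fin.castLE _ i) i.2, zsmul_eq_mul]
      push_cast
      rfl
    -- For `r = 0` a single vertical argument kills `β`, and the bracket in slot `0` is one, so no
    -- bracket term survives.
    · rcases r with _ | r
      · refine Finset.sum_eq_zero fun i _ => Finset.sum_eq_zero fun j _ => ?_
        refine smul_eq_zero_of_right _ (hhor.self_of_nhds _ (fun _ => 0)
          (fun a b _ => by omega) fun _ => hbr i.castSucc j.succ)
      · have hk : k = r + s := by omega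
        rw [sum_sum_Ici_eq_castLE (m := r + 1) (by omega)]
        · refine Finset.sum_congr rfl fun i _ => Finset.sum_congr rfl fun j _ => ?_
          rw [zsmul_eq_mul, hVX (Fin.castSucc (Fin.castLE _ i)) (Nat.lt_succ_of_lt i.2),
            hVX (Fin.succ (Fin.castLE _ j)) (Nat.succ_lt_succ j.2)]
          have h1 : (Fin.castSucc (Fin.castLE (by omega) i) : Fin (k + 2)).removeNth
              (fun l => V l y₀) = appendArgs h (i.castSucc.removeNth fun l => X l y₀)
                fun b => A y₀ (t b) :=
            removeNth_appendArgs h h' _ _ _ _ rfl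
          rw [h1, removeNth_appendArgs hk h _ _ _ j rfl, vecCons_appendArgs hk h]
          push_cast
          rfl
        -- The pair is `(i, j + 1)`, so here its second member is a lift. At most one vertical field
        -- has been removed; the bracket and the vertical fields that follow it fill enough leading
        -- slots to kill `β`.
        · intro i j hij hj
          refine smul_eq_zero_of_right _ (hhor.self_of_nhds _ (Fin.castLE (by omega))
            (Fin.castLE_injective _) fun a => ?_)
          refine Fin.cases (hbr _ _) (fun l => ?_) a
          refine hV0.self_of_nhds _ ?_
          simp only [Fin.succAbove, Fin.lt_def, Fin.val_castSucc]
          have := l.2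
          split_ifs <;> simp at * <;> omega
  -- Derivative along a lift: all `r + 1` vertical fields remain as arguments, so the differentiated
  -- function is zero on a neighbourhood.
  · intro i hi
    refine smul_eq_zero_of_right _ ?_
    rw [Filter.EventuallyEq.fderiv_eq (f := fun _ => 0)]
    · simp
    · filter_upwards [hhor, hV0] with y hy hy'
      refine hy _ (Fin.castLE (by omega)) (Fin.castLE_injective _) fun a => ?_
      refine hy' _ ?_
      have := a.2
      rw [Fin.succAbove_of_castSucc_lt _ _ (by rw [Fin.lt_def]; simp; omega)]
      simp
      omega

end Local

/-! ### Alternating maps and right inverses -/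

section LinearAlgebra

/-- Evaluation on tuples of basis vectors embeds the alternating maps linearly into a
finite-dimensional space. A linear left inverse is continuous there, so it recovers `f`
differentiably from its evaluations. -/
theorem differentiableAt_continuousAlternatingMap_of_apply {G : Type*} [NormedAddCommGroup G]
    [NormedSpace ℝ G] {T : Type*} [NormedAddCommGroup T] [NormedSpace ℝ T]
    [FiniteDimensional ℝ T] {s : ℕ} {f : G → T [⋀^Fin s]→L[ℝ] ℝ} {x : G}
    (h : ∀ t, DifferentiableAt ℝ (fun y => f y t) x) : DifferentiableAt ℝ f x := by
  let b := Module.finBasis ℝ T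
  let L : (T [⋀^Fin s]→L[ℝ] ℝ) →ₗ[ℝ] ((Fin s → Fin (Module.finrank ℝ T)) → ℝ) :=
    { toFun := fun g c => g fun i => b (c i)
      map_add' := fun _ _ => rfl
      map_smul' := fun _ _ => rfl }
  have hL : L.ker = ⊥ := by
    refine LinearMap.ker_eq_bot'.2 fun g hg => ?_
    refine ContinuousAlternatingMap.toAlternatingMap_injective ?_
    exact Module.Basis.ext_alternating b fun c _ => congrFun hg c
  obtain ⟨K, hK⟩ := L.exists_leftInverse_of_injective hL
  have hf : f = fun y => LinearMap.toContinuousLinearMap K (L (f y)) :=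
    funext fun y => (LinearMap.congr_fun hK (f y)).symm
  rw [hf]
  exact (ContinuousLinearMap.differentiableAt _).comp x (differentiableAt_pi.2 fun c => h _)

/-- If `α` vanishes on more than `r` vectors of `V`, then `α (v₁, …, v_r, u₁, …, u_s)` with
`v_i ∈ V` depends only on the classes of the `u_j` modulo `V`. -/
theorem map_appendArgs_congr {W : Type*} [NormedAddCommGroup W] [NormedSpace ℝ W] {N r s : ℕ}
    (h : N = r + s) {V : Submodule ℝ W} {α : W [⋀^Fin N]→L[ℝ] ℝ}
    (hα : ∀ (w : Fin N → W) (f : Fin (r + 1) → Fin N), Function.Injective f →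
      (∀ a, w (f a) ∈ V) → α w = 0) {v : Fin r → W} (hv : ∀ a, v a ∈ V) {u u' : Fin s → W}
    (hu : ∀ b, u' b - u b ∈ V) : α (appendArgs h v u) = α (appendArgs h v u') := by
  classical
  subst h
  have key (S : Finset (Fin s)) :
      α (appendArgs rfl v (S.piecewise u' u)) = α (appendArgs rfl v u) := by
    induction S using Finset.induction_on with
    | empty => simp
    | insert b S hb ih =>
      rw [← ih, Finset.piecewise_insert, ← sub_eq_zero]
      have h1 (w : Fin s → W) (x : W) : appendArgs rfl v (Function.update w b x)
          = Function.update (appendArgs rfl v w) (Fin.natAdd r b) x :=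
        append_update_right v w b x
      have h2 : S.piecewise u' u = Function.update (S.piecewise u' u) b (u b) := by
        rw [← Finset.piecewise_eq_of_notMem S u' u hb, Function.update_eq_self]
      rw [congrArg (fun w => α (appendArgs rfl v w)) h2, h1, h1, ← α.map_update_sub]
      -- Exchanging `u b` for `u' b` changes the value by a term with `u' b - u b` in slot `b`. That
      -- slot and the `r` slots of `v` are `r + 1` slots with entries in `V`.
      refine hα _ (Fin.snoc (α := fun _ => Fin (r + s)) (Fin.castAdd s) (Fin.natAdd r b)) ?_ ?_
      · rw [Fin.snoc_injective_iff]
        refine ⟨Fin.castAdd_injective r s, ?_⟩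
        rintro ⟨a, ha⟩
        have := congrArg Fin.val ha
        simp at this
        omega
      · refine Fin.lastCases ?_ fun a => ?_
        · rw [Fin.snoc_last, Function.update_self]
          exact hu b
        · rw [Fin.snoc_castSucc, Function.update_of_ne]
          · rw [appendArgs_of_lt rfl v _ (l := Fin.castAdd s a) a.2]
            exact hv a
          · intro ha
            have := congrArg Fin.val ha
            simp at this
            omega
  have := key Finset.univ
  rwa [Finset.piecewise_univ, eq_comm] at this

/-- A right inverse of the derivative at one point extends to a differentiable family of right
inverses near this point. -/
theorem exists_rightInverse_fderiv {EM EP : Type*} [NormedAddCommGroup EM] [NormedSpace ℝ EM]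
    [CompleteSpace EM] [NormedAddCommGroup EP] [NormedSpace ℝ EP] {F : EP → EM} {y₀ : EP}
    (hF : DifferentiableAt ℝ (fderiv ℝ F) y₀) (σ : EM →L[ℝ] EP)
    (hσ : ∀ t, fderiv ℝ F y₀ (σ t) = t) :
    ∃ A : EP → EM →L[ℝ] EP, DifferentiableAt ℝ A y₀ ∧
      ∀ᶠ y in nhds y₀, ∀ t, fderiv ℝ F y (A y t) = t := by
  let B : EP → EM →L[ℝ] EM := fun y => (fderiv ℝ F y).comp σ
  have hB : DifferentiableAt ℝ B y₀ := hF.clm_comp (differentiableAt_const _)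
  have hB0 : B y₀ = ((1 : (EM →L[ℝ] EM)ˣ) : EM →L[ℝ] EM) := ContinuousLinearMap.ext hσ
  -- The composite `B y` of `DF` with `σ` is the identity at `y₀`, hence invertible nearby;
  -- precomposing `σ` with its inverse corrects it to a right inverse.
  refine ⟨fun y => σ.comp (Ring.inverse (B y)), ?_, ?_⟩
  · refine (differentiableAt_const _).clm_comp ?_
    have h1 : DifferentiableAt ℝ Ring.inverse (B y₀) := by
      rw [hB0]
      exact (contDiffAt_ringInverse ℝ (n := 1) _).differentiableAt one_ne_zero
    exact h1.comp y₀ hB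
  · have h1 : ∀ᶠ y in nhds y₀, IsUnit (B y) :=
      hB.continuousAt.eventually (Units.isOpen.mem_nhds (by rw [hB0]; exact Units.isUnit _))
    filter_upwards [h1] with y hy t
    exact congrArg (fun C : EM →L[ℝ] EM => C t) (Ring.mul_inverse_cancel _ hy)

end LinearAlgebra

/-! ### Projection, vertical fields and brackets in the preferred chart -/

section Chart

variable {EM : Type*} [NormedAddCommGroup EM] [NormedSpace ℝ EM]
  {EP : Type*} [NormedAddCommGroup EP] [NormedSpace ℝ EP]
  {M : Type*} [TopologicalSpace M] [ChartedSpace EM M]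
  {P : Type*} [TopologicalSpace P] [ChartedSpace EP P]

/-- The preferred chart at `p` transports `π` to this map between the model spaces. -/
noncomputable abbrev projInChart (EM EP : Type*) [NormedAddCommGroup EM] [NormedSpace ℝ EM]
    [NormedAddCommGroup EP] [NormedSpace ℝ EP] {M : Type*} [TopologicalSpace M]
    [ChartedSpace EM M] {P : Type*} [TopologicalSpace P] [ChartedSpace EP P]
    (π : P → M) (p : P) : EP → EM :=
  writtenInExtChartAt 𝓘(ℝ, EP) 𝓘(ℝ, EM) p π

theorem contDiffAt_projInChart {π : P → M} (hπ : ContMDiff 𝓘(ℝ, EP) 𝓘(ℝ, EM) ∞ π) (p : P) :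
    ContDiffAt ℝ ∞ (projInChart EM EP π p) (extChartAt 𝓘(ℝ, EP) p p) := by
  have := (contMDiffAt_iff.1 (hπ p)).2
  rw [modelWithCornersSelf_coe, Set.range_id, contDiffWithinAt_univ] at this
  exact this

theorem mfderiv_eq_fderiv_projInChart {π : P → M} (hπ : ContMDiff 𝓘(ℝ, EP) 𝓘(ℝ, EM) ∞ π)
    (p : P) : mfderiv 𝓘(ℝ, EP) 𝓘(ℝ, EM) π p
      = fderiv ℝ (projInChart EM EP π p) (extChartAt 𝓘(ℝ, EP) p p) := by
  rw [((hπ p).mdifferentiableAt (by simp)).mfderiv, modelWithCornersSelf_coe, Set.range_id,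
    fderivWithin_univ]

theorem eventually_mem_target_and_source {π : P → M} (hπ : Continuous π) (p : P) :
    ∀ᶠ y in nhds (extChartAt 𝓘(ℝ, EP) p p), y ∈ (extChartAt 𝓘(ℝ, EP) p).target ∧
      π ((extChartAt 𝓘(ℝ, EP) p).symm y) ∈ (extChartAt 𝓘(ℝ, EM) (π p)).source := by
  have h1 : Filter.Tendsto (extChartAt 𝓘(ℝ, EP) p).symm (nhds (extChartAt 𝓘(ℝ, EP) p p))
      (nhds p) := by
    have := continuousAt_extChartAt_symm (I := 𝓘(ℝ, EP)) p
    rwa [ContinuousAt, extChartAt_to_inv] at this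
  have h3 : ∀ᶠ y in nhds (extChartAt 𝓘(ℝ, EP) p p), y ∈ (extChartAt 𝓘(ℝ, EP) p).target :=
    extChartAt_target_mem_nhds p
  exact h3.and (((hπ.tendsto p).comp h1).eventually
    (extChartAt_source_mem_nhds (I := 𝓘(ℝ, EM)) (π p)))

/-- The derivative of the inverse of the preferred chart at `p`, as a map of the model space. -/
noncomputable def symmDeriv (EP : Type*) [NormedAddCommGroup EP] [NormedSpace ℝ EP] {P : Type*}
    [TopologicalSpace P] [ChartedSpace EP P] (p : P) (y : EP) : EP →L[ℝ] EP :=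
  mfderiv 𝓘(ℝ, EP) 𝓘(ℝ, EP) (extChartAt 𝓘(ℝ, EP) p).symm y

/-- Replaces the count of vertical arguments by an injective choice of `r + 1` vertical slots, the
form in which the local computation exhibits them. -/
theorem IsHorizontal.apply_eq_zero {N r s : ℕ} (h : N ≤ r + s) {π : P → M} {η : FormField EP P N}
    (hη : IsHorizontal (EM := EM) π s η) (p : P) (w : Fin N → TangentSpace 𝓘(ℝ, EP) p)
    (f : Fin (r + 1) → Fin N) (hf : Function.Injective f)
    (hw : ∀ a, w (f a) ∈ verticalSpace EM EP π p) : η p w = 0 := by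
  refine hη p w ?_
  have := Nat.card_le_card_of_injective
    (fun a => (⟨f a, hw a⟩ : {i : Fin N // w i ∈ verticalSpace EM EP π p}))
    fun a b hab => hf (congrArg Subtype.val hab)
  rw [Nat.card_fin] at this
  omega

variable [IsManifold 𝓘(ℝ, EP) ∞ P]

/-- The coordinate expression of a vertical field in the preferred chart at `p`. -/
noncomputable def VerticalField.inChart {π : P → M} (Z : VerticalField EM EP π) (p : P) : EP → EP :=
  VectorField.mpullbackWithin 𝓘(ℝ, EP) 𝓘(ℝ, EP) (extChartAt 𝓘(ℝ, EP) p).symm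
    (fun q => (Z.toFun q : TangentSpace 𝓘(ℝ, EP) q)) (Set.range 𝓘(ℝ, EP))

/-- The tangent space at `p` is identified with the model space through the preferred chart at `p`,
so at the centre no change of coordinates appears. -/
theorem symmDeriv_self (p : P) :
    symmDeriv EP p (extChartAt 𝓘(ℝ, EP) p p) = ContinuousLinearMap.id ℝ EP := by
  have := mfderivWithin_range_extChartAt_symm (I := 𝓘(ℝ, EP)) (x := p)
  rw [modelWithCornersSelf_coe, Set.range_id, mfderivWithin_univ] at this
  exact this

theorem isInvertible_symmDeriv (p : P) {y : EP} (hy : y ∈ (extChartAt 𝓘(ℝ, EP) p).target) :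
    (symmDeriv EP p y).IsInvertible := by
  have := isInvertible_mfderivWithin_extChartAt_symm (I := 𝓘(ℝ, EP)) hy
  rwa [modelWithCornersSelf_coe, Set.range_id, mfderivWithin_univ] at this

theorem symmDeriv_inChart {π : P → M} (Z : VerticalField EM EP π) (p : P) {y : EP}
    (hy : y ∈ (extChartAt 𝓘(ℝ, EP) p).target) :
    symmDeriv EP p y (Z.inChart p y) = (Z.toFun ((extChartAt 𝓘(ℝ, EP) p).symm y)).1 := by
  have h1 : Z.inChart p y
      = (symmDeriv EP p y).inverse (Z.toFun ((extChartAt 𝓘(ℝ, EP) p).symm y)).1 := by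
    change VectorField.mpullbackWithin _ _ _ _ _ _ = _
    rw [VectorField.mpullbackWithin_apply, modelWithCornersSelf_coe, Set.range_id,
      mfderivWithin_univ]
    rfl
  rw [h1]
  exact (isInvertible_symmDeriv p hy).self_apply_inverse _

theorem inChart_self {π : P → M} (Z : VerticalField EM EP π) (p : P) :
    Z.inChart p (extChartAt 𝓘(ℝ, EP) p p) = (Z.toFun p).1 := by
  have h := symmDeriv_inChart Z p (mem_extChartAt_target (I := 𝓘(ℝ, EP)) p)
  rw [symmDeriv_self, ContinuousLinearMap.id_apply] at h
  refine h.trans ?_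
  exact congrArg (fun q => ((Z.toFun q).1 : EP)) (extChartAt_to_inv (I := 𝓘(ℝ, EP)) p)

theorem differentiableAt_inChart [CompleteSpace EP] {π : P → M} (Z : VerticalField EM EP π)
    (p : P) : DifferentiableAt ℝ (Z.inChart p) (extChartAt 𝓘(ℝ, EP) p p) := by
  have h2P : IsManifold 𝓘(ℝ, EP) 2 P := IsManifold.of_le (n := ∞) ENat.LEInfty.out
  have := MDifferentiableWithinAt.differentiableWithinAt_mpullbackWithin_vectorField
    (I := 𝓘(ℝ, EP)) (s := Set.univ) (x := p)
    (V := fun q => (Z.toFun q : TangentSpace 𝓘(ℝ, EP) q))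
    ((Z.smooth p).mdifferentiableAt (by simp)).mdifferentiableWithinAt
  have hr : (extChartAt 𝓘(ℝ, EP) p).symm ⁻¹' Set.univ ∩ Set.range 𝓘(ℝ, EP) = Set.univ := by
    simp
  rw [hr] at this
  exact differentiableWithinAt_univ.1 this

theorem extD_apply_eq {N : ℕ} (η : FormField EP P N) (p : P) :
    extD η p = extDeriv (inChart η p) (extChartAt 𝓘(ℝ, EP) p p) := by
  rw [extD, mfderiv_extChartAt_self]
  rfl

variable [IsManifold 𝓘(ℝ, EM) ∞ M]

theorem bracket_apply_eq_lieBracket_inChart [FiniteDimensional ℝ EP] {π : P → M}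
    (hπ : ContMDiff 𝓘(ℝ, EP) 𝓘(ℝ, EM) ∞ π) (X Y : VerticalField EM EP π) (p : P) :
    ((X.bracket hπ Y).toFun p : TangentSpace 𝓘(ℝ, EP) p)
      = VectorField.lieBracket ℝ (X.inChart p) (Y.inChart p) (extChartAt 𝓘(ℝ, EP) p p) := by
  change VectorField.mlieBracket _ _ _ _ = _
  rw [VectorField.mlieBracket, VectorField.mlieBracketWithin_apply, mfderiv_extChartAt_self]
  refine (congrArg (fun L : EP →L[ℝ] EP => L _)
    (ContinuousLinearMap.inverse_id (R := ℝ) (M := EP))).trans ?_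
  have hr : (extChartAt 𝓘(ℝ, EP) p).symm ⁻¹' Set.univ ∩ Set.range 𝓘(ℝ, EP) = Set.univ := by
    simp
  rw [hr]
  exact congrFun (VectorField.lieBracketWithin_univ (V := X.inChart p) (W := Y.inChart p)) _

/-- The derivative of the coordinate expression of `π`. -/
theorem fderiv_projInChart {π : P → M} (hπ : ContMDiff 𝓘(ℝ, EP) 𝓘(ℝ, EM) ∞ π) (p : P) {y : EP}
    (hy : y ∈ (extChartAt 𝓘(ℝ, EP) p).target)
    (hy' : π ((extChartAt 𝓘(ℝ, EP) p).symm y) ∈ (extChartAt 𝓘(ℝ, EM) (π p)).source) (w : EP) :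
    fderiv ℝ (projInChart EM EP π p) y w = mfderiv 𝓘(ℝ, EM) 𝓘(ℝ, EM) (extChartAt 𝓘(ℝ, EM) (π p))
      (π ((extChartAt 𝓘(ℝ, EP) p).symm y)) (mfderiv 𝓘(ℝ, EP) 𝓘(ℝ, EM) π
        ((extChartAt 𝓘(ℝ, EP) p).symm y) (symmDeriv EP p y w)) := by
  have hm1 : MDifferentiableAt 𝓘(ℝ, EP) 𝓘(ℝ, EP) (extChartAt 𝓘(ℝ, EP) p).symm y := by
    have := mdifferentiableWithinAt_extChartAt_symm (I := 𝓘(ℝ, EP)) hy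
    rwa [modelWithCornersSelf_coe, Set.range_id, mdifferentiableWithinAt_univ] at this
  have hm2 : MDifferentiableAt 𝓘(ℝ, EP) 𝓘(ℝ, EM) π ((extChartAt 𝓘(ℝ, EP) p).symm y) :=
    (hπ _).mdifferentiableAt (by simp)
  have hm3 : MDifferentiableAt 𝓘(ℝ, EM) 𝓘(ℝ, EM) (extChartAt 𝓘(ℝ, EM) (π p))
      (π ((extChartAt 𝓘(ℝ, EP) p).symm y)) :=
    mdifferentiableAt_extChartAt (by simpa using hy')
  have hc := (HasMFDerivAt.comp y hm3.hasMFDerivAt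
    (HasMFDerivAt.comp y hm2.hasMFDerivAt hm1.hasMFDerivAt)).mfderiv
  exact (congrArg (fun L : EP →L[ℝ] EM => L w)
    (mfderiv_eq_fderiv (f := projInChart EM EP π p) (x := y)).symm).trans
    (congrArg (fun L : EP →L[ℝ] EM => L w) hc)

/-- The chart of `M` has injective derivative, so verticality can be tested in coordinates near `p`,
also off the fiber through `p`. -/
theorem fderiv_projInChart_eq_zero_iff {π : P → M} (hπ : ContMDiff 𝓘(ℝ, EP) 𝓘(ℝ, EM) ∞ π)
    (p : P) {y : EP} (hy : y ∈ (extChartAt 𝓘(ℝ, EP) p).target)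
    (hy' : π ((extChartAt 𝓘(ℝ, EP) p).symm y) ∈ (extChartAt 𝓘(ℝ, EM) (π p)).source) (w : EP) :
    fderiv ℝ (projInChart EM EP π p) y w = 0 ↔
      symmDeriv EP p y w ∈ verticalSpace EM EP π ((extChartAt 𝓘(ℝ, EP) p).symm y) := by
  rw [fderiv_projInChart hπ p hy hy' w]
  have hi := isInvertible_mfderiv_extChartAt (I := 𝓘(ℝ, EM)) hy'
  exact map_eq_zero_iff (mfderiv 𝓘(ℝ, EM) 𝓘(ℝ, EM) (extChartAt 𝓘(ℝ, EM) (π p))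
      (π ((extChartAt 𝓘(ℝ, EP) p).symm y))) hi.injective

/-- On the fiber through `p` the chart of `M` is only differentiated at its centre `π p`, where its
derivative is the identity. Thus vectors `t` need no conversion there, in agreement with
`asFunction`. -/
theorem fderiv_projInChart_of_mem_fiber {π : P → M} (hπ : ContMDiff 𝓘(ℝ, EP) 𝓘(ℝ, EM) ∞ π)
    (p : P) {y : EP} (hy : y ∈ (extChartAt 𝓘(ℝ, EP) p).target)
    (hy' : π ((extChartAt 𝓘(ℝ, EP) p).symm y) = π p) (w : EP) :
    fderiv ℝ (projInChart EM EP π p) y w = mfderiv 𝓘(ℝ, EP) 𝓘(ℝ, EM) π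
        ((extChartAt 𝓘(ℝ, EP) p).symm y) (symmDeriv EP p y w) := by
  rw [fderiv_projInChart hπ p hy (by rw [hy']; exact mem_extChartAt_source _) w]
  have key (m : M) (hm : m = π p) (u : EM) :
      (mfderiv 𝓘(ℝ, EM) 𝓘(ℝ, EM) (extChartAt 𝓘(ℝ, EM) (π p)) m : EM →L[ℝ] EM) u = u := by
    subst hm
    exact congrArg (fun L : EM →L[ℝ] EM => L u) (mfderiv_extChartAt_self (I := 𝓘(ℝ, EM)))
  exact key _ hy' _

end Chart

/-! ### Derivatives along the fibers -/

section VerticalDerivative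

variable {EM : Type*} [NormedAddCommGroup EM] [NormedSpace ℝ EM] [FiniteDimensional ℝ EM]
  {EP : Type*} [NormedAddCommGroup EP] [NormedSpace ℝ EP]
  {M : Type*} [TopologicalSpace M] [ChartedSpace EM M]
  {P : Type*} [TopologicalSpace P] [ChartedSpace EP P]

/-- Every vector in the kernel of a surjective derivative is the velocity of a curve in the
level set. -/
theorem exists_curve_in_fiber [CompleteSpace EP] {F : EP → EM} {y₀ : EP}
    (hF : ContDiffAt ℝ ∞ F y₀) (hs : Function.Surjective (fderiv ℝ F y₀)) {v : EP}
    (hv : fderiv ℝ F y₀ v = 0) :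
    ∃ c : ℝ → EP, c 0 = y₀ ∧ HasDerivAt c v 0 ∧ ∀ᶠ τ in nhds 0, F (c τ) = F y₀ := by
  have hst : HasStrictFDerivAt F (fderiv ℝ F y₀) y₀ := hF.hasStrictFDerivAt (by simp)
  have hr : (fderiv ℝ F y₀ : EP →ₗ[ℝ] EM).range = ⊤ := LinearMap.range_eq_top.2 hs
  -- The implicit function parametrizes the level set by the kernel, with the inclusion as
  -- derivative at `0`; the curve is the image of the line `τ • v`.
  let ψ := hst.implicitFunction F (fderiv ℝ F y₀) hr (F y₀)
  let l : ℝ → (fderiv ℝ F y₀ : EP →ₗ[ℝ] EM).ker := fun τ => τ • ⟨v, hv⟩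
  have hl : HasDerivAt l ⟨v, hv⟩ 0 := by
    have := (hasDerivAt_id (0 : ℝ)).smul_const
      (⟨v, hv⟩ : (fderiv ℝ F y₀ : EP →ₗ[ℝ] EM).ker)
    rwa [one_smul] at this
  have hl0 : l 0 = 0 := zero_smul _ _
  have hψ : HasFDerivAt ψ (fderiv ℝ F y₀ : EP →ₗ[ℝ] EM).ker.subtypeL (l 0) := by
    rw [hl0]
    exact (hst.to_implicitFunction hr).hasFDerivAt
  refine ⟨ψ ∘ l, ?_, hψ.comp_hasDerivAt 0 hl, ?_⟩
  · simp [ψ, hl0]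
  · have h1 := hst.map_implicitFunction_eq hr
    have h2 : Filter.Tendsto (fun τ => (F y₀, l τ)) (nhds 0) (nhds (F y₀, 0)) := by
      have h3 := (continuousAt_const (y := F y₀)).prodMk hl.continuousAt
      rwa [ContinuousAt, hl0] at h3
    exact h2.eventually h1

/-- A derivative within the fiber need not be unique as a linear map, but its value on the velocity
of a curve in the fiber is. Agreement of `φ` with `Φ` on the fiber alone therefore suffices. -/
theorem vertDirDeriv_eq_fderiv [CompleteSpace EP] {π : P → M}
    (hπ : ContMDiff 𝓘(ℝ, EP) 𝓘(ℝ, EM) ∞ π) {s : ℕ}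
    (φ : Π p : P, (TangentSpace 𝓘(ℝ, EM) (π p)) [⋀^Fin s]→L[ℝ] ℝ) (p : P)
    (v : verticalSpace EM EP π p)
    (hs : Function.Surjective (fderiv ℝ (projInChart EM EP π p) (extChartAt 𝓘(ℝ, EP) p p)))
    {Φ : EP → EM [⋀^Fin s]→L[ℝ] ℝ} (hΦ : DifferentiableAt ℝ Φ (extChartAt 𝓘(ℝ, EP) p p))
    (hφ : ∀ᶠ y in nhds (extChartAt 𝓘(ℝ, EP) p p),
      π ((extChartAt 𝓘(ℝ, EP) p).symm y) = π p →
        asFunction φ ((extChartAt 𝓘(ℝ, EP) p).symm y) = Φ y) :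
    vertDirDeriv φ p v = fderiv ℝ Φ (extChartAt 𝓘(ℝ, EP) p p) v.1 := by
  set y₀ := extChartAt 𝓘(ℝ, EP) p p with hy₀
  set S : Set EP := (extChartAt 𝓘(ℝ, EP) p).symm ⁻¹' (π ⁻¹' {π p}) ∩ Set.range 𝓘(ℝ, EP) with hS
  let g : EP → EM [⋀^Fin s]→L[ℝ] ℝ :=
    writtenInExtChartAt 𝓘(ℝ, EP) 𝓘(ℝ, EM [⋀^Fin s]→L[ℝ] ℝ) p (asFunction φ)
  have hp0 : (extChartAt 𝓘(ℝ, EP) p).symm y₀ = p := extChartAt_to_inv (I := 𝓘(ℝ, EP)) p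
  have hg : HasFDerivWithinAt g (fderiv ℝ Φ y₀) S y₀ := by
    refine hΦ.hasFDerivAt.hasFDerivWithinAt.congr_of_eventuallyEq ?_ ?_
    · filter_upwards [self_mem_nhdsWithin, mem_nhdsWithin_of_mem_nhds hφ] with y hy hy'
      exact hy' hy.1
    · exact hφ.self_of_nhds (by rw [hp0])
  have hcont : ContinuousWithinAt (asFunction φ) (π ⁻¹' {π p}) p := by
    have h1 : ContinuousAt (Φ ∘ extChartAt 𝓘(ℝ, EP) p) p :=
      ContinuousAt.comp hΦ.continuousAt (continuousAt_extChartAt p)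
    refine h1.continuousWithinAt.congr_of_eventuallyEq ?_ ?_
    · have h2 := (continuousAt_extChartAt (I := 𝓘(ℝ, EP)) p).eventually hφ
      filter_upwards [self_mem_nhdsWithin, mem_nhdsWithin_of_mem_nhds h2,
        mem_nhdsWithin_of_mem_nhds (extChartAt_source_mem_nhds (I := 𝓘(ℝ, EP)) p)] with q hq hq' hqs
      rw [(extChartAt 𝓘(ℝ, EP) p).left_inv hqs] at hq'
      exact hq' hq
    · have := hφ.self_of_nhds (by rw [hp0])
      rwa [hp0] at this
  have hm : HasMFDerivWithinAt 𝓘(ℝ, EP) 𝓘(ℝ, EM [⋀^Fin s]→L[ℝ] ℝ) (asFunction φ)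
      (π ⁻¹' {π p}) p (fderiv ℝ Φ y₀) := ⟨hcont, hg⟩
  -- `hm` has the derivative of `Φ`, `hm'` the one chosen by `mfderivWithin`; they are compared
  -- along the curve `c`.
  have hm' := hm.mdifferentiableWithinAt.hasMFDerivWithinAt
  have hv : fderiv ℝ (projInChart EM EP π p) y₀ v.1 = 0 := by
    rw [← mfderiv_eq_fderiv_projInChart hπ p]
    exact v.2
  obtain ⟨c, hc0, hc, hcF⟩ := exists_curve_in_fiber (contDiffAt_projInChart hπ p) hs hv
  have hcS : ∀ᶠ τ in nhds 0, c τ ∈ S := by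
    have h1 : Filter.Tendsto c (nhds 0) (nhds y₀) := by
      have h2 := hc.continuousAt.tendsto
      rwa [hc0] at h2
    filter_upwards [hcF, h1.eventually (eventually_mem_target_and_source (EM := EM) hπ.continuous p)]
      with τ hτ hτ'
    refine ⟨?_, by simp⟩
    refine (extChartAt 𝓘(ℝ, EM) (π p)).injOn hτ'.2 (mem_extChartAt_source _) ?_
    refine hτ.trans ?_
    change extChartAt 𝓘(ℝ, EM) (π p) (π ((extChartAt 𝓘(ℝ, EP) p).symm y₀)) = _
    rw [hp0]
  have e1 := HasFDerivWithinAt.comp_hasDerivAt 0 (hc0.symm ▸ hm.2) hc hcS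
  have e2 := HasFDerivWithinAt.comp_hasDerivAt 0 (hc0.symm ▸ hm'.2) hc hcS
  exact e2.unique e1

end VerticalDerivative

/-! ### The symbol in coordinates and its vertical closedness -/

section Main

variable {EM : Type*} [NormedAddCommGroup EM] [NormedSpace ℝ EM]
  {EP : Type*} [NormedAddCommGroup EP] [NormedSpace ℝ EP]
  {EQ : Type*} [NormedAddCommGroup EQ] [NormedSpace ℝ EQ]
  {M : Type*} [TopologicalSpace M] [ChartedSpace EM M] [IsManifold 𝓘(ℝ, EM) ∞ M]
  {P : Type*} [TopologicalSpace P] [ChartedSpace EP P] [IsManifold 𝓘(ℝ, EP) ∞ P]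
  {Q : Type*} [TopologicalSpace Q] [ChartedSpace EQ Q]

/-- On the fiber through `p`, the symbol can be computed in the chart at `p` with any family of
right inverses of the derivative of the coordinate expression of `π`. -/
theorem symbol_apply_eq_inChart {π : P → M} (hπ : IsSmoothFiberBundle EM EP EQ Q π)
    {N r s : ℕ}
    (h : N = r + s) {η : FormField EP P N} (h_hor : IsHorizontal (EM := EM) π s η) {p q : P}
    {y : EP} (hy : y ∈ (extChartAt 𝓘(ℝ, EP) p).target)
    (hq : (extChartAt 𝓘(ℝ, EP) p).symm y = q) (hqp : π q = π p) {B : EM →L[ℝ] EP}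
    (hB : ∀ t, fderiv ℝ (projInChart EM EP π p) y (B t) = t)
    (v : Fin r → verticalSpace EM EP π q) {v' : Fin r → EP}
    (hv : ∀ a, symmDeriv EP p y (v' a) = (v a).1) (t : Fin s → EM) :
    symbol hπ h η q v t
      = inChart η p y (appendArgs h v' fun b => B (t b)) := by
  subst hq
  let q := (extChartAt 𝓘(ℝ, EP) p).symm y
  have h1 : inChart η p y (appendArgs h v' fun b => B (t b))
      = (η q : EP [⋀^Fin N]→L[ℝ] ℝ) (appendArgs (W := EP) h (fun a => (v a).1)
          fun b => symmDeriv EP p y (B (t b))) := by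
    let v₁ : Fin r → EP := fun a => (v a).1
    have hv₁ : (fun a => symmDeriv EP p y (v' a)) = v₁ := funext hv
    have h2 := comp_appendArgs h (symmDeriv EP p y) v' fun b => B (t b)
    rw [hv₁] at h2
    exact congrArg (η q : EP [⋀^Fin N]→L[ℝ] ℝ) h2
  rw [h1]
  -- Both lifts of `t b` project to `t b`, so they differ by a vertical vector.
  refine map_appendArgs_congr (W := EP) (V := verticalSpace EM EP π q) (α := η q) h
    (fun w f hf hw => h_hor.apply_eq_zero h.le q w f hf hw) (fun a => (v a).2)
    (u := fun b => splitting hπ q (t b)) fun b => ?_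
  have h2 : mfderiv 𝓘(ℝ, EP) 𝓘(ℝ, EM) π q (splitting hπ q (t b)) = t b :=
    (exists_splitting hπ q).choose_spec (t b)
  have h3 : mfderiv 𝓘(ℝ, EP) 𝓘(ℝ, EM) π q (symmDeriv EP p y (B (t b))) = t b :=
    (fderiv_projInChart_of_mem_fiber hπ.smooth_proj p hy hqp _).symm.trans (hB _)
  let L : EP →L[ℝ] EM := mfderiv 𝓘(ℝ, EP) 𝓘(ℝ, EM) π q
  have h4 (x x' : EP) (hx : L x = t b) (hx' : L x' = t b) : L (x - x') = 0 := by
    rw [map_sub, hx, hx', sub_self]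
  exact h4 _ _ h3 h2

variable [FiniteDimensional ℝ EM] [FiniteDimensional ℝ EP]

/-- The pointwise chosen splitting prevents differentiating the symbol directly. The lifts `A` give
a differentiable substitute with the same values on the fiber through `p`. -/
theorem vertDirDeriv_symbol {π : P → M}
    (hπ : IsSmoothFiberBundle EM EP EQ Q π) {N r s : ℕ} (h : N = r + s) {η : FormField EP P N}
    (h_hor : IsHorizontal (EM := EM) π s η) (p : P)
    (hη : DifferentiableAt ℝ (inChart η p) (extChartAt 𝓘(ℝ, EP) p p))
    {A : EP → EM →L[ℝ] EP} (hA : DifferentiableAt ℝ A (extChartAt 𝓘(ℝ, EP) p p))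
    (hFA : ∀ᶠ y in nhds (extChartAt 𝓘(ℝ, EP) p p), ∀ t,
      fderiv ℝ (projInChart EM EP π p) y (A y t) = t)
    (Z : Fin r → VerticalField EM EP π) (v : verticalSpace EM EP π p) (t : Fin s → EM) :
    vertDirDeriv (fun q => symbol hπ h η q fun l => (Z l).toFun q) p v t
      = fderiv ℝ (fun y => inChart η p y
          (appendArgs h (fun l => (Z l).inChart p y) fun b => A y (t b)))
          (extChartAt 𝓘(ℝ, EP) p p) v.1 := by
  have : CompleteSpace EP := FiniteDimensional.complete ℝ EP
  -- The subspace `⊤` avoids a dependence on the vertical space, which varies with `y`.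
  let Φ : EP → EM [⋀^Fin s]→L[ℝ] ℝ := fun y =>
    linearSymbol h ⊤ (A y) (inChart η p y) fun l => ⟨(Z l).inChart p y, trivial⟩
  have hΦt (t : Fin s → EM) (y : EP) : Φ y t = inChart η p y
      (appendArgs h (fun l => (Z l).inChart p y) fun b => A y (t b)) := rfl
  have hΦ : DifferentiableAt ℝ Φ (extChartAt 𝓘(ℝ, EP) p p) := by
    refine differentiableAt_continuousAlternatingMap_of_apply fun t => ?_
    refine hη.continuousAlternatingMap_apply (g := fun l y =>
      appendArgs h (fun l => (Z l).inChart p y) (fun b => A y (t b)) l) fun l => ?_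
    by_cases hl : (l : ℕ) < r
    · simp only [appendArgs_of_lt _ _ _ hl]
      exact differentiableAt_inChart _ _
    · simp only [appendArgs_of_ge _ _ _ (not_lt.1 hl)]
      exact hA.clm_apply (differentiableAt_const _)
  rw [vertDirDeriv_eq_fderiv hπ.smooth_proj _ p v
    (fun t => ⟨_, hFA.self_of_nhds t⟩) hΦ]
  · exact (fderiv_continuousAlternatingMap_apply_const_apply hΦ t v.1).symm
  · have h3 : ∀ᶠ y in nhds (extChartAt 𝓘(ℝ, EP) p p), y ∈ (extChartAt 𝓘(ℝ, EP) p).target :=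
      extChartAt_target_mem_nhds p
    filter_upwards [h3, hFA] with y hy hyA hyp
    ext t
    exact symbol_apply_eq_inChart hπ h h_hor hy rfl hyp hyA _
      (fun a => symmDeriv_inChart (Z a) p hy) t

/-- The symbol of an `s`-horizontal `(k + 1)`-form `η` is vertically closed if `d η` is
`(s + 1)`-horizontal. -/
theorem vertExtD_symbol_eq_zero {π : P → M}
    (hπ : IsSmoothFiberBundle EM EP EQ Q π) {k r s : ℕ} (h : k + 1 = r + s)
    {η : FormField EP P (k + 1)} (h_smooth : IsSmoothForm η)
    (h_hor : IsHorizontal (EM := EM) π s η)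
    (h_horD : IsHorizontal (EM := EM) π (s + 1) (extD η)) :
    vertExtD hπ.smooth_proj (symbol hπ h η) = 0 := by
  have : CompleteSpace EP := FiniteDimensional.complete ℝ EP
  have : CompleteSpace EM := FiniteDimensional.complete ℝ EM
  funext X p
  ext t
  set y₀ := extChartAt 𝓘(ℝ, EP) p p with hy₀
  have hF := contDiffAt_projInChart hπ.smooth_proj p
  have hη : DifferentiableAt ℝ (inChart η p) y₀ :=
    ((h_smooth p).contDiffAt (extChartAt_target_mem_nhds p)).differentiableAt (by simp)
  have hFd : DifferentiableAt ℝ (fderiv ℝ (projInChart EM EP π p)) y₀ :=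
    (hF.fderiv_right (m := 1)
      (by rw [one_add_one_eq_two]; exact ENat.LEInfty.out)).differentiableAt one_ne_zero
  obtain ⟨A, hA, hFA⟩ := exists_rightInverse_fderiv hFd (splitting hπ p) (by
    rw [← mfderiv_eq_fderiv_projInChart hπ.smooth_proj p]
    exact (exists_splitting hπ p).choose_spec)
  have hev := eventually_mem_target_and_source (EM := EM) (EP := EP) hπ.smooth_proj.continuous p
  have key := sum_fderiv_eq_sum_lieBracket h hF hη hA hFA
    (X := fun i => (X i).inChart p) (fun i => differentiableAt_inChart _ _)
    (by
      filter_upwards [hev] with y hy i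
      rw [fderiv_projInChart_eq_zero_iff hπ.smooth_proj p hy.1 hy.2, symmDeriv_inChart _ _ hy.1]
      exact ((X i).toFun _).2)
    (by
      filter_upwards [hev] with y hy w f hf hw
      exact h_hor.apply_eq_zero h.le _ (fun l => symmDeriv EP p y (w l)) f hf fun a =>
        (fderiv_projInChart_eq_zero_iff hπ.smooth_proj p hy.1 hy.2 _).1 (hw a))
    (by
      intro w f hf hw
      rw [← extD_apply_eq]
      refine h_horD.apply_eq_zero (by omega) p w f hf fun a => ?_
      refine LinearMap.mem_ker.2 ?_
      refine Eq.trans ?_ (hw a)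
      rw [← mfderiv_eq_fderiv_projInChart hπ.smooth_proj p]
      rfl) t
  have hsum : (∑ i : Fin (r + 1), (-1 : ℝ) ^ (i : ℕ) • vertDirDeriv
      (fun q => symbol hπ h η q (fun l => (X (i.succAbove l)).toFun q)) p ((X i).toFun p)) t
      = ∑ i : Fin (r + 1), (-1) ^ (i : ℕ) * fderiv ℝ (fun y => inChart η p y (appendArgs h
        (i.removeNth fun l => (X l).inChart p y) fun b => A y (t b))) y₀ ((X i).inChart p y₀) := by
    rw [ContinuousAlternatingMap.sum_apply]
    refine Finset.sum_congr rfl fun i _ => ?_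
    rw [inChart_self]
    exact congrArg (fun x => (-1) ^ (i : ℕ) * x) (vertDirDeriv_symbol hπ h h_hor p hη hA hFA
      (fun l => X (i.succAbove l)) ((X i).toFun p) t)
  rw [vertExtD, ContinuousAlternatingMap.add_apply, hsum, key]
  -- For `r = 0` both bracket sums are empty. Otherwise they cancel term by term, as `bracketSum`
  -- has the sign `(-1)^(i+j+1)` and `lieBracketSum` the sign `(-1)^(i+j)`.
  rcases r with _ | r
  · exact add_zero _
  · have hp0 : (extChartAt 𝓘(ℝ, EP) p).symm y₀ = p := extChartAt_to_inv (I := 𝓘(ℝ, EP)) p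
    have hb (v : Fin (r + 1) → verticalSpace EM EP π p) : symbol hπ h η p v t
        = inChart η p y₀ (appendArgs h (fun a => (v a).1) fun b => A y₀ (t b)) := by
      refine symbol_apply_eq_inChart hπ h h_hor (mem_extChartAt_target p) hp0 rfl
        hFA.self_of_nhds v (fun a => ?_) t
      rw [symmDeriv_self]
      rfl
    change _ = (0 : ℝ)
    rw [bracketSum, lieBracketSum, ContinuousAlternatingMap.sum_apply, ← Finset.sum_add_distrib]
    refine Finset.sum_eq_zero fun i _ => ?_
    rw [ContinuousAlternatingMap.sum_apply, ← Finset.sum_add_distrib]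
    refine Finset.sum_eq_zero fun j _ => ?_
    rw [ContinuousAlternatingMap.smul_apply, smul_eq_mul, hb, ← add_assoc, pow_succ, mul_neg_one,
      neg_mul, ← sub_eq_add_neg, sub_eq_zero]
    congr 3
    funext a
    refine Fin.cases ?_ (fun l => ?_) a
    · exact (bracket_apply_eq_lieBracket_inChart hπ.smooth_proj _ _ p).symm
    · exact inChart_self _ p

end Main

end FibForm

theorem mainTheorem10
    {EM EP EQ : Type*}
    [NormedAddCommGroup EM] [NormedSpace ℝ EM] [FiniteDimensional ℝ EM]
    [NormedAddCommGroup EP] [NormedSpace ℝ EP] [FiniteDimensional ℝ EP]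
    [NormedAddCommGroup EQ] [NormedSpace ℝ EQ] [FiniteDimensional ℝ EQ]
    {M : Type*} [TopologicalSpace M] [T2Space M] [SecondCountableTopology M]
    [ChartedSpace EM M] [IsManifold 𝓘(ℝ, EM) ∞ M]
    {P : Type*} [TopologicalSpace P] [T2Space P] [SecondCountableTopology P]
    [ChartedSpace EP P] [IsManifold 𝓘(ℝ, EP) ∞ P]
    {Q : Type*} [TopologicalSpace Q] [T2Space Q] [SecondCountableTopology Q]
    [ChartedSpace EQ Q] [IsManifold 𝓘(ℝ, EQ) ∞ Q]
    (π : P → M) (hπ : IsSmoothFiberBundle EM EP EQ Q π)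
    (k r : ℕ) (hr : r ≤ k + 1)
    (η : FormField EP P (k + 1)) (h_smooth : IsSmoothForm η)
    (h_hor : IsHorizontal (EM := EM) π (k + 1 - r) η) :
    (IsHorizontal (EM := EM) π (k + 2 - r) (extD η) →
      vertExtD hπ.smooth_proj (symbol hπ (Nat.add_sub_of_le hr).symm η) = 0) ∧
    (extD η = 0 →
      vertExtD hπ.smooth_proj (symbol hπ (Nat.add_sub_of_le hr).symm η) = 0) := by
  -- Since `r ≤ k + 1`, the truncated subtraction loses nothing, and `dη` has horizontality degree
  -- `s + 1`.
  have hs : k + 2 - r = k + 1 - r + 1 := by omega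
  rw [hs]
  have key := vertExtD_symbol_eq_zero hπ (Nat.add_sub_of_le hr).symm h_smooth h_hor
  refine ⟨key, fun h0 => key fun p w _ => ?_⟩
  rw [h0]
  rfl
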